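/- A metric space $X$ is geodesic if any two points $p,q$ are joined by a geodesic, that is, a map $\sigma:[0,d(p,q)]\to X$ from $p$ to $q$ with $d(\sigma(s),\sigma(t))=|s-t|$. It is CAT($0$) if it is geodesic and the distance between any two points of any geodesic triangle is at most the distance between the corresponding points of the triangle with the same side lengths in the Euclidean plane (completeness is not assumed). In a CAT($0$) space geodesics between given endpoints are unique, and the angle between two nontrivial geodesics starting at a common point is the greatest lower bound of the corresponding angles in the Euclidean model triangles for initial subsegments of the two geodesics. The total rotation of a polygonal (piecewise geodesic) curve $\sigma$ with nondegenerate segments is $\tau_\sigma=\sum_i(\pi-\beta_i)$, where $\beta_i$ are the angles at its interior vertices. The total curvature of a curve on a compact interval $[a,b]$ is the limit superior, in $[0,\infty]$, of $\tau_\sigma$ over the polygonal curves $\sigma$ inscribed in it (with vertices at successive parameters of a subdivision of $[a,b]$) as the maximal segment length of $\sigma$ tends to $0$. **Theorem.** Let $X$ be a CAT($0$) space and let $\gamma:[0,\infty)\to X$ be a curve parametrized by arclength, i.e. the length of $\gamma|_{[s,t]}$ is $t-s$ for all $0\le s\le t$. For $t\ge 0$ let $\tau(t)\in[0,\infty]$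 be the total curvature of $\gamma|_{[0,t]}$, and let $c(t)$ be the smallest number such that $\gamma([0,t])$ lies in the closed ball of radius $c(t)$ about $\gamma(0)$. (a) If $\liminf_{t\to\infty}\tau(t)/t=0$, then $\gamma$ is unbounded. (b) If $a\in(0,1)$ and $\tau\in O(t^a)$ as $t\to\infty$ (there is a constant $A$ with $\tau(t)\le A t^a$ for all sufficiently large $t$), then $c\in\Omega(t^{1-a})$ as $t\to\infty$ (there is a constant $k>0$ with $c(t)\ge k\,t^{1-a}$ for all sufficiently large $t$). -/

import Mathlib

open Set Filter
open scoped ENNReal Topology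

noncomputable section

namespace CurveCAT0

variable {X : Type*} [MetricSpace X]

/-- `σ`, restricted to `[0, dist p q]`, is a (unit speed, minimizing) geodesic from `p` to `q`. -/
def IsGeodesic (σ : ℝ → X) (p q : X) : Prop :=
  σ 0 = p ∧ σ (dist p q) = q ∧
    ∀ s ∈ Icc 0 (dist p q), ∀ t ∈ Icc 0 (dist p q), dist (σ s) (σ t) = |s - t|

/-- `X` is a CAT(0) space: a geodesic metric space in which the distance between two points of a
geodesic triangle is at most the distance between the corresponding points of a model triangle
`p' q' r'` with the same side lengths in the Euclidean plane. For two points on one side this is an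
equality; for points on different sides, `p` names the common vertex of these sides (the third
side exists by `exists_geodesic`). -/
structure IsCAT0 (X : Type*) [MetricSpace X] : Prop where
  exists_geodesic : ∀ p q : X, ∃ σ : ℝ → X, IsGeodesic σ p q
  comparison : ∀ (p q r : X) (σ ρ : ℝ → X), IsGeodesic σ p q → IsGeodesic ρ p r →
    ∀ p' q' r' : EuclideanSpace ℝ (Fin 2),
      dist p' q' = dist p q → dist q' r' = dist q r → dist p' r' = dist p r →
    ∀ s ∈ Icc 0 (dist p q), ∀ t ∈ Icc 0 (dist p r),
    ∀ x' ∈ segment ℝ p' q', ∀ y' ∈ segment ℝ p' r', dist p' x' = s → dist p' y' = t →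
      dist (σ s) (ρ t) ≤ dist x' y'

/-- The angle at the vertex corresponding to `p` in the Euclidean model triangle with the side
lengths of `p x y` (law of cosines); meaningful for `x ≠ p` and `y ≠ p`. -/
def modelAngle (p x y : X) : ℝ :=
  Real.arccos ((dist p x ^ 2 + dist p y ^ 2 - dist x y ^ 2) / (2 * dist p x * dist p y))

/-- The angle at `p` between the geodesics from `p` to `x` and from `p` to `y`: the greatest lower
bound of the model angles of the triangles formed by nontrivial initial subsegments. In a CAT(0)
space the geodesics `σ` and `ρ` are unique. Meaningful for `x ≠ p` and `y ≠ p`. -/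
def angle (p x y : X) : ℝ :=
  sInf {θ : ℝ | ∃ σ ρ : ℝ → X, IsGeodesic σ p x ∧ IsGeodesic ρ p y ∧
    ∃ s ∈ Ioc 0 (dist p x), ∃ t ∈ Ioc 0 (dist p y), θ = modelAngle p (σ s) (ρ t)}

/-- The total rotation `∑ (π - βᵢ)` of the polygonal curve with successive vertices
`v 0, …, v n`, where `βᵢ` are the angles at the interior vertices `v 1, …, v (n - 1)`. -/
def totalRotation (n : ℕ) (v : ℕ → X) : ℝ :=
  ∑ i ∈ Finset.range (n - 1), (Real.pi - angle (v (i + 1)) (v i) (v (i + 2)))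

/-- The points `u 0 < ⋯ < u n` subdivide `[a, b]`, and successive points of `γ` at these parameters
are distinct, so that they are the vertices of a polygonal curve inscribed in `γ|[a, b]` with
nondegenerate segments. -/
def IsInscribed (γ : ℝ → X) (a b : ℝ) (n : ℕ) (u : ℕ → ℝ) : Prop :=
  u 0 = a ∧ u n = b ∧ ∀ i < n, u i < u (i + 1) ∧ γ (u i) ≠ γ (u (i + 1))

/-- The total curvature of `γ|[a, b]`, in `[0, ∞]`: the limit superior of the total rotation of
inscribed polygonal curves as the maximal length of their segments tends to `0`. -/
def totalCurvature (γ : ℝ → X) (a b : ℝ) : ℝ≥0∞ :=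
  ⨅ (δ : ℝ) (_ : 0 < δ), ⨆ (n : ℕ) (u : ℕ → ℝ) (_ : IsInscribed γ a b n u)
    (_ : ∀ i < n, dist (γ (u i)) (γ (u (i + 1))) < δ),
      ENNReal.ofReal (totalRotation n (fun i => γ (u i)))

/-- The total curvature function of a curve `γ` on `[0, ∞)`. -/
def tau (γ : ℝ → X) (t : ℝ) : ℝ≥0∞ := totalCurvature γ 0 t

/-- The circumradius function: `circumradius γ t` is the smallest `r` such that `γ|[0, t]` lies in
the ball of radius `r` about `γ 0`. -/
def circumradius (γ : ℝ → X) (t : ℝ) : ℝ :=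
  sInf {r : ℝ | γ '' Icc 0 t ⊆ Metric.closedBall (γ 0) r}

end CurveCAT0

end

namespace CurveCAT0

variable {X : Type*} [MetricSpace X]

/-! Everything rests on the inequality `t ≤ r * (1 + τ(t))` when `γ([0, t])` lies in the ball of
radius `r` about `p = γ 0` (`le_mul_one_add_tau`). Part (a) follows because a bounded curve then has
`τ(t) / t ≥ 1 / (2r)` eventually, and part (b) by solving for `r`.

For an inscribed polygon, split each edge `xy` by projecting `p` onto it. In the plane the pieces
are `|px| cos x` and `|py| cos y`; in a CAT(0) space angles are at most model angles, so the sum of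
these terms is at least `|xy|` (`dist_le_cos_angle`). Regroup the terms by vertex: an interior
vertex with angle `β`, split by the direction to `p` into `α` and `α'`, contributes `|pv| (cos α +
cos α') ≤ r (π - β)`, because `β ≤ α + α'` (`angle_triangle`, `cos_add_cos_le`). The start
contributes nothing and the end at most `r`, so the length is at most `r (1 + rotation)`. Fine
inscribed polygons of almost full length carry this over to the curve. -/

/-! ### Geodesics and model triangles -/

theorem IsGeodesic.dist_left {σ : ℝ → X} {p q : X} (h : IsGeodesic σ p q) {s : ℝ}
    (hs : s ∈ Icc 0 (dist p q)) : dist p (σ s) = s := by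
  have := h.2.2 0 ⟨le_rfl, dist_nonneg⟩ s hs
  rw [h.1] at this
  rw [this, zero_sub, abs_neg, abs_of_nonneg hs.1]

theorem IsGeodesic.initial {σ : ℝ → X} {p q : X} (h : IsGeodesic σ p q) {s : ℝ}
    (hs : s ∈ Icc 0 (dist p q)) : IsGeodesic σ p (σ s) := by
  have hd := h.dist_left hs
  refine ⟨h.1, by rw [hd], fun a ha b hb => ?_⟩
  rw [hd] at ha hb
  exact h.2.2 a ⟨ha.1, ha.2.trans hs.2⟩ b ⟨hb.1, hb.2.trans hs.2⟩

/-- The law of cosines for a model triangle. -/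
theorem two_mul_cos_modelAngle {p x y : X} (hx : x ≠ p) (hy : y ≠ p) :
    2 * dist p x * dist p y * Real.cos (modelAngle p x y)
      = dist p x ^ 2 + dist p y ^ 2 - dist x y ^ 2 := by
  have hx' : 0 < dist p x := dist_pos.2 hx.symm
  have hy' : 0 < dist p y := dist_pos.2 hy.symm
  have h1 : dist x y ≤ dist p x + dist p y := by
    rw [dist_comm p x]; exact dist_triangle _ _ _
  have h2 : dist p x ≤ dist p y + dist x y := by
    rw [dist_comm x y]; exact dist_triangle _ _ _
  have h3 : dist p y ≤ dist p x + dist x y := dist_triangle _ _ _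
  have hpos : 0 < 2 * dist p x * dist p y := by positivity
  have hd : 0 ≤ dist x y := dist_nonneg
  rw [modelAngle, Real.cos_arccos]
  · field_simp
  · rw [le_div_iff₀ hpos]; nlinarith
  · rw [div_le_iff₀ hpos]
    nlinarith [mul_nonneg (sub_nonneg.2 h2) (sub_nonneg.2 h3)]

theorem modelAngle_le_of_dist_sq_le {p x y : X} (hx : x ≠ p) (hy : y ≠ p) {θ : ℝ} (h0 : 0 ≤ θ)
    (hπ : θ ≤ Real.pi)
    (h : dist x y ^ 2 ≤ dist p x ^ 2 + dist p y ^ 2 - 2 * dist p x * dist p y * Real.cos θ) :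
    modelAngle p x y ≤ θ := by
  have hx' : 0 < dist p x := dist_pos.2 hx.symm
  have hy' : 0 < dist p y := dist_pos.2 hy.symm
  rw [← Real.arccos_cos h0 hπ, modelAngle]
  apply Real.arccos_le_arccos
  rw [le_div_iff₀ (by positivity)]
  linarith

theorem dist_sq_le_of_modelAngle_le {p x y : X} (hx : x ≠ p) (hy : y ≠ p) {θ : ℝ}
    (hπ : θ ≤ Real.pi) (h : modelAngle p x y ≤ θ) :
    dist x y ^ 2 ≤ dist p x ^ 2 + dist p y ^ 2 - 2 * dist p x * dist p y * Real.cos θ := by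
  have hx' : 0 < dist p x := dist_pos.2 hx.symm
  have hy' : 0 < dist p y := dist_pos.2 hy.symm
  have hc := Real.cos_le_cos_of_nonneg_of_le_pi (Real.arccos_nonneg _) hπ h
  have hm := two_mul_cos_modelAngle hx hy
  rw [modelAngle] at hm
  have := mul_le_mul_of_nonneg_left hc (by positivity : 0 ≤ 2 * dist p x * dist p y)
  linarith

/-- Comparison with the degenerate triangle `p q q`: both points correspond to the same planar
point. -/
theorem IsCAT0.geodesic_unique (hX : IsCAT0 X) {p q : X} {σ ρ : ℝ → X} (hσ : IsGeodesic σ p q)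
    (hρ : IsGeodesic ρ p q) {s : ℝ} (hs : s ∈ Icc 0 (dist p q)) : σ s = ρ s := by
  rcases eq_or_ne p q with rfl | hpq
  · have : s = 0 := by simpa using hs
    rw [this, hσ.1, hρ.1]
  have hd : 0 < dist p q := dist_pos.2 hpq
  let q' : EuclideanSpace ℝ (Fin 2) := !₂[dist p q, 0]
  have hq' : ‖q'‖ = dist p q := by
    simp [q', EuclideanSpace.norm_eq, Fin.sum_univ_two, Real.sqrt_sq]
  have hmem : (s / dist p q) • q' ∈ segment ℝ 0 q' :=
    ⟨1 - s / dist p q, s / dist p q, by rw [sub_nonneg]; exact (div_le_one hd).2 hs.2,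
      div_nonneg hs.1 hd.le, by ring, by simp⟩
  have hdist : dist 0 ((s / dist p q) • q') = s := by
    rw [dist_zero_left, norm_smul, hq', Real.norm_of_nonneg (div_nonneg hs.1 hd.le)]
    field_simp
  have := hX.comparison p q q σ ρ hσ hρ 0 q' q' (by rw [dist_zero_left, hq']) (by simp)
    (by rw [dist_zero_left, hq']) s hs s hs _ hmem _ hmem hdist hdist
  rw [dist_self] at this
  exact dist_le_zero.1 this

/-- Model angles are monotone in the lengths of the initial subsegments. -/
theorem IsCAT0.modelAngle_mono (hX : IsCAT0 X) {p x y : X} {σ ρ : ℝ → X} (hσ : IsGeodesic σ p x)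
    (hρ : IsGeodesic ρ p y) {s s' t t' : ℝ} (hs : s ∈ Ioc 0 (dist p x))
    (ht : t ∈ Ioc 0 (dist p y)) (hs' : s' ∈ Ioc 0 s) (ht' : t' ∈ Ioc 0 t) :
    modelAngle p (σ s') (ρ t') ≤ modelAngle p (σ s) (ρ t) := by
  have ds := hσ.dist_left ⟨hs.1.le, hs.2⟩
  have dt := hρ.dist_left ⟨ht.1.le, ht.2⟩
  have ds' := hσ.dist_left ⟨hs'.1.le, hs'.2.trans hs.2⟩
  have dt' := hρ.dist_left ⟨ht'.1.le, ht'.2.trans ht.2⟩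
  have ne : ∀ {z : X} {r : ℝ}, 0 < r → dist p z = r → z ≠ p := fun hr hz =>
    (dist_pos.1 (hz ▸ hr)).symm
  have hlaw := two_mul_cos_modelAngle (ne hs.1 ds) (ne ht.1 dt)
  rw [ds, dt] at hlaw
  set θ := modelAngle p (σ s) (ρ t) with hθ
  let v : EuclideanSpace ℝ (Fin 2) := !₂[1, 0]
  let w : EuclideanSpace ℝ (Fin 2) := !₂[Real.cos θ, Real.sin θ]
  have hv : ‖v‖ = 1 := by simp [v, EuclideanSpace.norm_eq, Fin.sum_univ_two]
  have hw : ‖w‖ = 1 := by simp [w, EuclideanSpace.norm_eq, Fin.sum_univ_two]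
  have hvw : ∀ a b : ℝ, dist (a • v) (b • w) ^ 2 = a ^ 2 + b ^ 2 - 2 * a * b * Real.cos θ := by
    intro a b
    rw [EuclideanSpace.dist_eq, Real.sq_sqrt (by positivity)]
    simp only [Fin.sum_univ_two, Real.dist_eq, sq_abs, v, w]
    simp
    nlinarith [Real.sin_sq_add_cos_sq θ]
  have hnorm : ∀ (z : EuclideanSpace ℝ (Fin 2)) (a : ℝ), ‖z‖ = 1 → 0 < a → dist 0 (a • z) = a := by
    intro z a hz ha
    rw [dist_zero_left, norm_smul, hz, mul_one, Real.norm_of_nonneg ha.le]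
  have hseg : ∀ (z : EuclideanSpace ℝ (Fin 2)) (a b : ℝ), a ∈ Ioc 0 b →
      a • z ∈ segment ℝ 0 (b • z) := by
    intro z a b h
    have hb : 0 < b := h.1.trans_le h.2
    refine ⟨1 - a / b, a / b, by rw [sub_nonneg]; exact (div_le_one hb).2 h.2,
      div_nonneg h.1.le hb.le, by ring, ?_⟩
    rw [smul_zero, zero_add, smul_smul, div_mul_cancel₀ _ hb.ne']
  -- The planar triangle with apex `0` and sides `s • v`, `t • w` is the model triangle; shortening
  -- its sides keeps the apex angle `θ`.
  have hcmp := hX.comparison p (σ s) (ρ t) σ ρ (hσ.initial ⟨hs.1.le, hs.2⟩)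
    (hρ.initial ⟨ht.1.le, ht.2⟩) 0 (s • v) (t • w) (by rw [hnorm v s hv hs.1, ds])
    (by
      rw [← abs_of_nonneg (dist_nonneg (x := s • v)), ← abs_of_nonneg (dist_nonneg (x := σ s)),
        ← sq_eq_sq_iff_abs_eq_abs, hvw]
      linarith)
    (by rw [hnorm w t hw ht.1, dt]) s' (by rw [ds]; exact ⟨hs'.1.le, hs'.2⟩)
    t' (by rw [dt]; exact ⟨ht'.1.le, ht'.2⟩) _ (hseg v s' s hs') _ (hseg w t' t ht')
    (hnorm v s' hv hs'.1) (hnorm w t' hw ht'.1)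
  apply modelAngle_le_of_dist_sq_le (ne hs'.1 ds') (ne ht'.1 dt') (Real.arccos_nonneg _)
    (Real.arccos_le_pi _)
  rw [ds', dt']
  calc _ ≤ dist (s' • v) (t' • w) ^ 2 := pow_le_pow_left₀ dist_nonneg hcmp 2
    _ = _ := hvw s' t'

/-! ### Angles and their triangle inequality -/

theorem angle_nonneg (p x y : X) : 0 ≤ angle p x y := by
  apply Real.sInf_nonneg
  rintro _ ⟨σ, ρ, -, -, s, -, t, -, rfl⟩
  exact Real.arccos_nonneg _

theorem angle_le_modelAngle_geodesic {p x y : X} {σ ρ : ℝ → X} (hσ : IsGeodesic σ p x)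
    (hρ : IsGeodesic ρ p y) {s t : ℝ} (hs : s ∈ Ioc 0 (dist p x)) (ht : t ∈ Ioc 0 (dist p y)) :
    angle p x y ≤ modelAngle p (σ s) (ρ t) := by
  refine csInf_le ⟨0, ?_⟩ ⟨σ, ρ, hσ, hρ, s, hs, t, ht, rfl⟩
  rintro _ ⟨σ, ρ, -, -, s, -, t, -, rfl⟩
  exact Real.arccos_nonneg _

theorem IsCAT0.angle_le_modelAngle (hX : IsCAT0 X) {p x y : X} (hx : x ≠ p) (hy : y ≠ p) :
    angle p x y ≤ modelAngle p x y := by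
  obtain ⟨σ, hσ⟩ := hX.exists_geodesic p x
  obtain ⟨ρ, hρ⟩ := hX.exists_geodesic p y
  have := angle_le_modelAngle_geodesic hσ hρ ⟨dist_pos.2 hx.symm, le_rfl⟩
    ⟨dist_pos.2 hy.symm, le_rfl⟩
  rwa [hσ.2.1, hρ.2.1] at this

theorem IsCAT0.angle_le_pi (hX : IsCAT0 X) {p x y : X} (hx : x ≠ p) (hy : y ≠ p) :
    angle p x y ≤ Real.pi :=
  (hX.angle_le_modelAngle hx hy).trans (Real.arccos_le_pi _)

/-- Short initial subsegments have model angles close to the angle. -/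
theorem IsCAT0.exists_modelAngle_le (hX : IsCAT0 X) {p x y : X} (hx : x ≠ p) (hy : y ≠ p)
    {σ ρ : ℝ → X} (hσ : IsGeodesic σ p x) (hρ : IsGeodesic ρ p y) {θ : ℝ} (hθ : angle p x y < θ) :
    ∃ r > 0, r ≤ dist p x ∧ r ≤ dist p y ∧
      ∀ s ∈ Ioc 0 r, ∀ t ∈ Ioc 0 r, modelAngle p (σ s) (ρ t) ≤ θ := by
  have hne : {θ : ℝ | ∃ σ ρ : ℝ → X, IsGeodesic σ p x ∧ IsGeodesic ρ p y ∧
      ∃ s ∈ Ioc 0 (dist p x), ∃ t ∈ Ioc 0 (dist p y), θ = modelAngle p (σ s) (ρ t)}.Nonempty :=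
    ⟨_, σ, ρ, hσ, hρ, _, ⟨dist_pos.2 hx.symm, le_rfl⟩, _, ⟨dist_pos.2 hy.symm, le_rfl⟩, rfl⟩
  obtain ⟨_, ⟨σ', ρ', hσ', hρ', s, hs, t, ht, rfl⟩, hlt⟩ := exists_lt_of_csInf_lt hne hθ
  refine ⟨min s t, lt_min hs.1 ht.1, (min_le_left _ _).trans hs.2, (min_le_right _ _).trans ht.2,
    fun a ha b hb => ?_⟩
  have ha' : a ∈ Ioc 0 s := ⟨ha.1, ha.2.trans (min_le_left _ _)⟩
  have hb' : b ∈ Ioc 0 t := ⟨hb.1, hb.2.trans (min_le_right _ _)⟩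
  rw [hX.geodesic_unique hσ hσ' ⟨ha.1.le, ha'.2.trans hs.2⟩,
    hX.geodesic_unique hρ hρ' ⟨hb.1.le, hb'.2.trans ht.2⟩]
  exact (hX.modelAngle_mono hσ' hρ' hs ht ha' hb').trans hlt.le

/-- A planar triangle with apex angle `A + B` and two unit sides is divided by the ray that splits
the apex angle into `A` and `B`; squared lengths are given by the law of cosines. -/
theorem exists_split_isosceles {A B : ℝ} (hA : 0 < A) (hB : 0 < B) (hAB : A + B < Real.pi) :
    ∃ u ∈ Ioc (0 : ℝ) 1, ∃ a b : ℝ, 0 ≤ a ∧ 0 ≤ b ∧ a ^ 2 = 1 + u ^ 2 - 2 * u * Real.cos A ∧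
      b ^ 2 = 1 + u ^ 2 - 2 * u * Real.cos B ∧ (a + b) ^ 2 = 2 - 2 * Real.cos (A + B) := by
  have sA : 0 < Real.sin A := Real.sin_pos_of_pos_of_lt_pi hA (by linarith)
  have sB : 0 < Real.sin B := Real.sin_pos_of_pos_of_lt_pi hB (by linarith)
  have sAB : 0 < Real.sin (A + B) := Real.sin_pos_of_pos_of_lt_pi (by linarith) hAB
  have pA := Real.sin_sq_add_cos_sq A
  have pB := Real.sin_sq_add_cos_sq B
  have hsum := Real.sin_add A B
  have hcos := Real.cos_add A B
  set D := Real.sqrt (2 - 2 * Real.cos (A + B)) with hD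
  have hD2 : D ^ 2 = 2 - 2 * Real.cos (A + B) :=
    Real.sq_sqrt (by linarith [Real.cos_le_one (A + B)])
  have hS : 0 < Real.sin A + Real.sin B := by positivity
  -- Comparing areas gives the length `u` of the dividing segment, and shows that the base `D` is
  -- cut in the ratio `sin A : sin B`.
  refine ⟨Real.sin (A + B) / (Real.sin A + Real.sin B), ⟨by positivity, ?_⟩,
    Real.sin A / (Real.sin A + Real.sin B) * D, Real.sin B / (Real.sin A + Real.sin B) * D,
    by positivity, by positivity, ?_, ?_, ?_⟩
  · rw [div_le_one hS, hsum]
    nlinarith [Real.cos_le_one A, Real.cos_le_one B]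
  · rw [mul_pow, hD2, hsum, hcos]
    field_simp
    grind
  · rw [mul_pow, hD2, hsum, hcos]
    field_simp
    grind
  · rw [← add_mul, ← add_div, div_self hS.ne', one_mul, hD2]

/-- If it failed, short initial segments of lengths `r`, `u * r`, `r` would have model angles at
most `A` and `B` with `A + B < angle p x z`. The triangle inequality through the middle point bounds
the outer distance by the base of the planar triangle with apex angle `A + B`, so the outer model
angle would be below the angle. -/
theorem IsCAT0.angle_triangle (hX : IsCAT0 X) {p x y z : X} (hx : x ≠ p) (hy : y ≠ p)
    (hz : z ≠ p) : angle p x z ≤ angle p x y + angle p y z := by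
  by_contra! hlt
  obtain ⟨ε, hε, hε'⟩ : ∃ ε > 0, angle p x y + angle p y z + 3 * ε = angle p x z :=
    ⟨(angle p x z - (angle p x y + angle p y z)) / 3, by linarith, by ring⟩
  have hπ := hX.angle_le_pi hx hz
  obtain ⟨σ, hσ⟩ := hX.exists_geodesic p x
  obtain ⟨η, hη⟩ := hX.exists_geodesic p y
  obtain ⟨ρ, hρ⟩ := hX.exists_geodesic p z
  set A := angle p x y + ε
  set B := angle p y z + ε
  have hA : 0 < A := add_pos_of_nonneg_of_pos (angle_nonneg _ _ _) hε
  have hB : 0 < B := add_pos_of_nonneg_of_pos (angle_nonneg _ _ _) hε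
  have hAB : A + B < angle p x z := by simp only [A, B]; linarith
  obtain ⟨r₁, hr₁, hrx, hry, h₁⟩ := hX.exists_modelAngle_le hx hy hσ hη (lt_add_of_pos_right _ hε)
  obtain ⟨r₂, hr₂, hry', hrz, h₂⟩ := hX.exists_modelAngle_le hy hz hη hρ (lt_add_of_pos_right _ hε)
  obtain ⟨u, hu, a, b, ha, hb, ha2, hb2, hab⟩ := exists_split_isosceles hA hB (by linarith)
  set r := min r₁ r₂
  have hr : 0 < r := lt_min hr₁ hr₂
  have hr1 : r ≤ r₁ := min_le_left _ _
  have hr2 : r ≤ r₂ := min_le_right _ _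
  have hur : 0 < u * r := mul_pos hu.1 hr
  have hur' : u * r ≤ r := mul_le_of_le_one_left hr.le hu.2
  have ds := hσ.dist_left ⟨hr.le, hr1.trans hrx⟩
  have dt := hρ.dist_left ⟨hr.le, hr2.trans hrz⟩
  have du := hη.dist_left ⟨hur.le, hur'.trans (hr1.trans hry)⟩
  have ne : ∀ {z : X} {r : ℝ}, 0 < r → dist p z = r → z ≠ p := fun hr hz =>
    (dist_pos.1 (hz ▸ hr)).symm
  have e₁ := dist_sq_le_of_modelAngle_le (ne hr ds) (ne hur du) (by linarith)
    (h₁ r ⟨hr, hr1⟩ (u * r) ⟨hur, hur'.trans hr1⟩)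
  have e₂ := dist_sq_le_of_modelAngle_le (ne hur du) (ne hr dt) (by linarith)
    (h₂ (u * r) ⟨hur, hur'.trans hr2⟩ r ⟨hr, hr2⟩)
  rw [ds, du] at e₁
  rw [dt, du] at e₂
  have f₁ : dist (σ r) (η (u * r)) ≤ r * a := by
    apply le_of_sq_le_sq _ (by positivity)
    rw [mul_pow, ha2]; linarith
  have f₂ : dist (η (u * r)) (ρ r) ≤ r * b := by
    apply le_of_sq_le_sq _ (by positivity)
    rw [mul_pow, hb2]; linarith
  have f₃ : dist (σ r) (ρ r) ≤ r * (a + b) := by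
    linarith [dist_triangle (σ r) (η (u * r)) (ρ r)]
  have f₄ := pow_le_pow_left₀ dist_nonneg f₃ 2
  rw [mul_pow, hab] at f₄
  have := modelAngle_le_of_dist_sq_le (ne hr ds) (ne hr dt) (θ := A + B) (by positivity)
    (by linarith) (by rw [ds, dt]; linarith)
  linarith [angle_le_modelAngle_geodesic hσ hρ (s := r) (t := r) ⟨hr, hr1.trans hrx⟩
    ⟨hr, hr2.trans hrz⟩]

/-! ### Length and rotation of polygons in a ball -/

/-- The sum is `2 cos ((α + α') / 2) cos ((α - α') / 2)`, and `cos (β / 2) = sin ((π - β) / 2) ≤ (π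
- β) / 2`. -/
theorem cos_add_cos_le {α α' β : ℝ} (hα : 0 ≤ α) (hα' : 0 ≤ α') (hαπ : α ≤ Real.pi)
    (hα'π : α' ≤ Real.pi) (hβ : 0 ≤ β) (hβπ : β ≤ Real.pi) (h : β ≤ α + α') :
    Real.cos α + Real.cos α' ≤ Real.pi - β := by
  rw [Real.cos_add_cos]
  have h1 : 0 ≤ Real.cos ((α - α') / 2) :=
    Real.cos_nonneg_of_neg_pi_div_two_le_of_le (by linarith) (by linarith)
  have h2 : Real.cos ((α + α') / 2) ≤ Real.cos (β / 2) :=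
    Real.cos_le_cos_of_nonneg_of_le_pi (by linarith) (by linarith) (by linarith)
  have h3 : Real.cos (β / 2) ≤ (Real.pi - β) / 2 := by
    rw [← Real.sin_pi_div_two_sub]
    exact (Real.sin_le (by linarith)).trans (by linarith)
  have h4 : Real.cos ((α - α') / 2) ≤ 1 := Real.cos_le_one _
  have h5 : Real.cos ((α + α') / 2) ≤ (Real.pi - β) / 2 := h2.trans h3
  nlinarith [mul_le_mul_of_nonneg_right h5 h1]

/-- The left side is the signed projection of the side `xp` onto `xy` in the model triangle;
replacing the model angle by the smaller angle increases the cosine. -/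
theorem IsCAT0.dist_mul_cos_angle (hX : IsCAT0 X) {p x y : X} (hxy : y ≠ x) :
    (dist p x ^ 2 + dist x y ^ 2 - dist p y ^ 2) / (2 * dist x y)
        ≤ dist p x * Real.cos (angle x p y) ∧
      (dist p x ^ 2 + dist x y ^ 2 - dist p y ^ 2) / (2 * dist x y)
        ≤ dist p x * Real.cos (angle x y p) := by
  have hd : 0 < dist x y := dist_pos.2 hxy.symm
  rcases eq_or_ne p x with rfl | hp
  · simp
  have hdp : 0 < dist x p := dist_pos.2 hp.symm
  have c1 := Real.cos_le_cos_of_nonneg_of_le_pi (angle_nonneg x p y) (Real.arccos_le_pi _)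
    (hX.angle_le_modelAngle hp hxy)
  have c2 := Real.cos_le_cos_of_nonneg_of_le_pi (angle_nonneg x y p) (Real.arccos_le_pi _)
    (hX.angle_le_modelAngle hxy hp)
  have l1 := two_mul_cos_modelAngle hp hxy
  have l2 := two_mul_cos_modelAngle hxy hp
  rw [dist_comm y p] at l2
  rw [modelAngle] at l1 l2
  rw [dist_comm p x]
  have m1 := mul_le_mul_of_nonneg_left c1 (by positivity : 0 ≤ dist x p * (2 * dist x y))
  have m2 := mul_le_mul_of_nonneg_left c2 (by positivity : 0 ≤ dist x p * (2 * dist x y))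
  constructor <;> rw [div_le_iff₀ (by positivity)] <;> linarith

/-- An edge is at most as long as the sum of the projections of the two segments to `p`. -/
theorem IsCAT0.dist_le_cos_angle (hX : IsCAT0 X) (p : X) {x y : X} (hxy : x ≠ y) :
    dist x y ≤ dist p x * Real.cos (angle x p y) + dist p y * Real.cos (angle y x p) := by
  have h1 := (hX.dist_mul_cos_angle (p := p) hxy.symm).1
  have h2 := (hX.dist_mul_cos_angle (p := p) hxy).2
  have hd : 0 < dist x y := dist_pos.2 hxy
  rw [dist_comm y x] at h2
  have : dist x y = (dist p x ^ 2 + dist x y ^ 2 - dist p y ^ 2) / (2 * dist x y)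
      + (dist p y ^ 2 + dist x y ^ 2 - dist p x ^ 2) / (2 * dist x y) := by
    field_simp; ring
  linarith

/-- The last cosine term is the part of the final edge that still awaits its partner from the next
edge at `v (n + 1)`. -/
theorem IsCAT0.sum_dist_le_aux (hX : IsCAT0 X) (p : X) {r : ℝ} (v : ℕ → X) (n : ℕ)
    (hne : ∀ i < n + 1, v i ≠ v (i + 1)) (hr : ∀ i ≤ n + 1, dist p (v i) ≤ r) :
    ∑ i ∈ Finset.range (n + 1), dist (v i) (v (i + 1)) ≤
      dist p (v 0) + r * totalRotation (n + 1) v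
        + dist p (v (n + 1)) * Real.cos (angle (v (n + 1)) (v n) p) := by
  induction n with
  | zero =>
    have h1 := hX.dist_le_cos_angle p (hne 0 (by omega))
    have h2 := mul_le_of_le_one_right (dist_nonneg (x := p) (y := v 0))
      (Real.cos_le_one (angle (v 0) p (v 1)))
    simp only [totalRotation, zero_add, Finset.range_one, Finset.sum_singleton, Nat.sub_self,
      Finset.range_zero, Finset.sum_empty, mul_zero, add_zero] at *
    linarith
  | succ n ih =>
    have ih := ih (fun i hi => hne i (by omega)) (fun i hi => hr i (by omega))
    have hedge := hX.dist_le_cos_angle p (hne (n + 1) (by omega))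
    have ne1 : v n ≠ v (n + 1) := hne n (by omega)
    have ne2 : v (n + 2) ≠ v (n + 1) := (hne (n + 1) (by omega)).symm
    have hrot : totalRotation (n + 1 + 1) v = totalRotation (n + 1) v
        + (Real.pi - angle (v (n + 1)) (v n) (v (n + 2))) := by
      simp only [totalRotation, Nat.add_sub_cancel, Finset.sum_range_succ]
    have hβπ := hX.angle_le_pi ne1 ne2
    have hstep : dist p (v (n + 1)) * Real.cos (angle (v (n + 1)) (v n) p)
        + dist p (v (n + 1)) * Real.cos (angle (v (n + 1)) p (v (n + 2)))
        ≤ r * (Real.pi - angle (v (n + 1)) (v n) (v (n + 2))) := by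
      -- At `p` itself the direction to `p` is undefined, but the factor `dist p p` kills those
      -- angles.
      rcases eq_or_ne p (v (n + 1)) with hp | hp
      · rw [← hp, dist_self, zero_mul, zero_mul, add_zero]
        rw [← hp] at hβπ
        exact mul_nonneg (dist_nonneg.trans (hr 0 (by omega))) (sub_nonneg.2 hβπ)
      · rw [← mul_add]
        refine (mul_le_mul_of_nonneg_left (cos_add_cos_le (angle_nonneg _ _ _) (angle_nonneg _ _ _)
          (hX.angle_le_pi ne1 hp) (hX.angle_le_pi hp ne2) (angle_nonneg _ _ _) hβπ
          (hX.angle_triangle ne1 hp ne2)) dist_nonneg).trans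
          (mul_le_mul_of_nonneg_right (hr _ (by omega)) (sub_nonneg.2 hβπ))
    rw [Finset.sum_range_succ, hrot]
    linarith

/-- The length of a polygonal curve in a ball of radius `r` is bounded by its total rotation. -/
theorem IsCAT0.sum_dist_le (hX : IsCAT0 X) {r : ℝ} (v : ℕ → X) (n : ℕ)
    (hne : ∀ i < n, v i ≠ v (i + 1)) (hr : ∀ i ≤ n, dist (v 0) (v i) ≤ r) :
    ∑ i ∈ Finset.range n, dist (v i) (v (i + 1)) ≤ r * (1 + totalRotation n v) := by
  cases n with
  | zero => simpa [totalRotation] using hr 0 le_rfl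
  | succ n =>
    have h := hX.sum_dist_le_aux (v 0) v n hne hr
    have h2 := mul_le_of_le_one_right (dist_nonneg (x := v 0) (y := v (n + 1)))
      (Real.cos_le_one (angle (v (n + 1)) (v n) (v 0)))
    rw [dist_self] at h
    linarith [hr (n + 1) le_rfl]

/-! ### Inscribed polygons of almost full length -/

theorem dist_le_of_hasUnitSpeedOn {γ : ℝ → X} (hγ : HasUnitSpeedOn γ (Ici 0)) {s t : ℝ}
    (hs : 0 ≤ s) (hst : s ≤ t) : dist (γ s) (γ t) ≤ t - s := by
  have h := hγ (mem_Ici.2 hs) (mem_Ici.2 (hs.trans hst))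
  have hd := eVariationOn.edist_le γ (s := Ici 0 ∩ Icc s t) ⟨hs, le_rfl, hst⟩
    ⟨hs.trans hst, hst, le_rfl⟩
  rw [h, edist_dist, NNReal.coe_one, one_mul] at hd
  exact (ENNReal.ofReal_le_ofReal_iff (by linarith)).1 hd

theorem sum_sum_Ico_le {f : ℕ → ℝ} (hf : ∀ i, 0 ≤ f i) {m : ℕ → ℕ} (hm : Monotone m) (n : ℕ) :
    ∑ i ∈ Finset.range n, ∑ k ∈ Finset.Ico (m i) (m (i + 1)), f k
      ≤ ∑ k ∈ Finset.range (m n), f k := by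
  induction n with
  | zero => simpa using Finset.sum_nonneg fun i _ => hf i
  | succ n ih =>
    rw [Finset.sum_range_succ, ← Finset.sum_range_add_sum_Ico _ (hm n.le_succ)]
    linarith

/-- Fine uniform subdivisions have almost full length. -/
theorem exists_uniform_subdivision {γ : ℝ → X} (hγ : HasUnitSpeedOn γ (Ici 0)) {t ε δ : ℝ}
    (ht : 0 < t) (hε : 0 < ε) (hδ : 0 < δ) :
    ∃ N : ℕ, 0 < N ∧ t / N < δ ∧ t - ε < ∑ k ∈ Finset.range N,
      dist (γ (k * (t / N))) (γ ((k + 1 : ℕ) * (t / N))) := by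
  have hvar := hγ (mem_Ici.2 le_rfl) (mem_Ici.2 ht.le)
  rw [NNReal.coe_one, one_mul, sub_zero] at hvar
  have hlt : ENNReal.ofReal (t - ε / 2) < eVariationOn γ (Ici 0 ∩ Icc 0 t) := by
    rw [hvar]; exact (ENNReal.ofReal_lt_ofReal_iff ht).2 (by linarith)
  obtain ⟨⟨n, u, hu, hmem⟩, hsum⟩ := lt_iSup_iff.1 hlt
  simp only [edist_dist] at hsum
  rw [← ENNReal.ofReal_sum_of_nonneg fun _ _ => dist_nonneg] at hsum
  have hsum' : t - ε / 2 < ∑ i ∈ Finset.range n, dist (γ (u (i + 1))) (γ (u i)) :=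
    lt_of_not_ge fun h => hsum.not_ge (ENNReal.ofReal_le_ofReal h)
  -- Rounding the points `u i` down to the grid costs at most `2 * h` per edge, in total `2 * n * h
  -- < ε / 2`.
  obtain ⟨N, hN⟩ := exists_nat_gt (max (t / δ) (4 * (n + 1) * t / ε))
  have hN1 := (le_max_left _ _).trans_lt hN
  have hN2 := (le_max_right _ _).trans_lt hN
  have hN0 : (0 : ℝ) < N := lt_of_le_of_lt (by positivity) hN1
  set h := t / N with hh
  have hh0 : 0 < h := by positivity
  have hNh : N * h = t := by rw [hh]; field_simp
  have hnh : 4 * (n + 1) * h < ε := by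
    rw [div_lt_iff₀ hε] at hN2
    rw [hh, ← mul_div_assoc, div_lt_iff₀ hN0]; linarith
  refine ⟨N, by exact_mod_cast hN0, ?_, ?_⟩
  · rw [div_lt_iff₀ hδ] at hN1
    rw [div_lt_iff₀ hN0]; linarith
  let m : ℕ → ℕ := fun i => ⌊u i / h⌋₊
  have hm : Monotone m := fun i j hij =>
    Nat.floor_mono (div_le_div_of_nonneg_right (hu hij) hh0.le)
  have hmle : ∀ i, m i * h ≤ u i := fun i =>
    (le_div_iff₀ hh0).1 (Nat.floor_le (div_nonneg (hmem i).1 hh0.le))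
  have hmlt : ∀ i, u i < m i * h + h := fun i => by
    have := (div_lt_iff₀ hh0).1 (Nat.lt_floor_add_one (u i / h))
    linarith
  have hmN : m n ≤ N := by
    have := (hmle n).trans (hmem n).2.2
    rw [← hNh] at this
    exact_mod_cast le_of_mul_le_mul_right this hh0
  have hround : ∀ i, dist (γ (m i * h)) (γ (u i)) ≤ h := fun i =>
    (dist_le_of_hasUnitSpeedOn hγ (by positivity) (hmle i)).trans (by linarith [hmlt i])
  let f : ℕ → ℝ := fun k => dist (γ (k * h)) (γ ((k + 1 : ℕ) * h))
  have hedge : ∀ i, dist (γ (u (i + 1))) (γ (u i)) ≤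
      ∑ k ∈ Finset.Ico (m i) (m (i + 1)), f k + 2 * h := by
    intro i
    have h1 := dist_le_Ico_sum_dist (fun k : ℕ => γ (k * h)) (hm i.le_succ)
    have h2 := dist_triangle4 (γ (u i)) (γ (m i * h)) (γ (m (i + 1) * h)) (γ (u (i + 1)))
    rw [dist_comm]
    rw [dist_comm (γ (u i)) (γ (m i * h))] at h2
    simp only [f]
    linarith [hround i, hround (i + 1)]
  have h1 := Finset.sum_le_sum fun i (_ : i ∈ Finset.range n) => hedge i
  rw [Finset.sum_add_distrib, Finset.sum_const, Finset.card_range, nsmul_eq_mul] at h1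
  have h2 := sum_sum_Ico_le (f := f) (fun _ => dist_nonneg) hm n
  have h3 : ∑ k ∈ Finset.range (m n), f k ≤ ∑ k ∈ Finset.range N, f k :=
    Finset.sum_le_sum_of_subset_of_nonneg (Finset.range_mono hmN) fun _ _ _ => dist_nonneg
  change t - ε < ∑ k ∈ Finset.range N, f k
  nlinarith

/-- Removing a vertex that agrees with one of its neighbours does not change the length. -/
theorem sum_dist_remove (v : ℕ → X) {n k : ℕ} (hk : k < n)
    (hd : v k = v (k + 1) ∨ v (k + 1) = v (k + 2)) :
    ∑ i ∈ Finset.range n, dist (if i < k + 1 then v i else v (i + 1))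
        (if i + 1 < k + 1 then v (i + 1) else v (i + 1 + 1))
      = ∑ i ∈ Finset.range (n + 1), dist (v i) (v (i + 1)) := by
  obtain ⟨m, rfl⟩ := Nat.exists_eq_add_of_lt hk
  induction m with
  | zero =>
    have hfirst : ∑ i ∈ Finset.range k, dist (if i < k + 1 then v i else v (i + 1))
        (if i + 1 < k + 1 then v (i + 1) else v (i + 1 + 1))
          = ∑ i ∈ Finset.range k, dist (v i) (v (i + 1)) :=
      Finset.sum_congr rfl fun i hi => by
        have := Finset.mem_range.1 hi
        rw [if_pos (by omega), if_pos (by omega)]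
    rw [add_zero, Finset.sum_range_succ, hfirst, Finset.sum_range_succ _ (k + 1),
      Finset.sum_range_succ _ k, if_pos (by omega), if_neg (by omega), add_assoc]
    rcases hd with hd | hd <;> simp [hd]
  | succ m ih =>
    have ih := ih (by omega)
    rw [show k + (m + 1) + 1 = (k + m + 1) + 1 by omega, Finset.sum_range_succ, ih,
      Finset.sum_range_succ _ (k + m + 1 + 1), if_neg (by omega), if_neg (by omega)]

/-- A uniform subdivision may repeat points of `γ`. Among subdivisions with the required mesh and
length, one with fewest segments has no degenerate segment, since a repeated vertex could be
deleted. -/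
theorem exists_isInscribed {γ : ℝ → X} (hγ : HasUnitSpeedOn γ (Ici 0)) {t ε δ : ℝ}
    (ht : 0 < t) (hε : 0 < ε) (hεt : ε ≤ t) (hδ : 0 < δ) :
    ∃ n u, IsInscribed γ 0 t n u ∧ (∀ i < n, dist (γ (u i)) (γ (u (i + 1))) < δ) ∧
      t - ε < ∑ i ∈ Finset.range n, dist (γ (u i)) (γ (u (i + 1))) := by
  let P : ℕ → Prop := fun n => ∃ u : ℕ → ℝ, Monotone u ∧ u 0 = 0 ∧ u n = t ∧
    (∀ i < n, dist (γ (u i)) (γ (u (i + 1))) < δ) ∧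
      t - ε < ∑ i ∈ Finset.range n, dist (γ (u i)) (γ (u (i + 1)))
  have hP : ∃ n, P n := by
    obtain ⟨N, hN, hNδ, hsum⟩ := exists_uniform_subdivision hγ ht hε hδ
    have hN' : (0 : ℝ) < N := by exact_mod_cast hN
    have hstep : 0 < t / N := by positivity
    refine ⟨N, fun k => k * (t / N), fun i j hij => ?_, by simp, by field_simp, fun i _ => ?_, hsum⟩
    · exact mul_le_mul_of_nonneg_right (by exact_mod_cast hij) hstep.le
    · refine (dist_le_of_hasUnitSpeedOn hγ (by positivity) ?_).trans_lt ?_ <;>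
      · push_cast; linarith
  classical
  obtain ⟨u, hu, hu0, hun, huδ, husum⟩ := Nat.find_spec hP
  have hmin : ∀ m < Nat.find hP, ¬ P m := fun m hm => Nat.find_min hP hm
  generalize Nat.find hP = n at *
  refine ⟨n, u, ⟨hu0, hun, fun i hi => ?_⟩, huδ, husum⟩
  suffices hne : γ (u i) ≠ γ (u (i + 1)) from
    ⟨lt_of_le_of_ne (hu i.le_succ) fun h => hne (by rw [h]), hne⟩
  intro heq
  obtain ⟨n, rfl⟩ : ∃ m, n = m + 1 := ⟨n - 1, by omega⟩
  -- A single degenerate segment has length `0`, which `ε ≤ t` excludes.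
  rcases Nat.eq_zero_or_pos n with rfl | hn
  · obtain rfl : i = 0 := by omega
    rw [zero_add, Finset.sum_range_one, heq, dist_self] at husum
    linarith
  -- The vertex `k + 1` to delete is interior, so that the endpoints `0` and `t` survive.
  obtain ⟨k, hk, hd⟩ : ∃ k < n, γ (u k) = γ (u (k + 1)) ∨ γ (u (k + 1)) = γ (u (k + 2)) := by
    rcases (Nat.lt_succ_iff.1 hi).lt_or_eq with h | rfl
    · exact ⟨i, h, Or.inl heq⟩
    · obtain ⟨m, rfl⟩ : ∃ m, i = m + 1 := ⟨i - 1, by omega⟩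
      exact ⟨m, by omega, Or.inr heq⟩
  have hγu : ∀ j, γ (if j < k + 1 then u j else u (j + 1))
      = if j < k + 1 then γ (u j) else γ (u (j + 1)) := fun j => apply_ite γ _ _ _
  refine hmin n (by omega) ⟨fun j => if j < k + 1 then u j else u (j + 1), fun a b hab => ?_,
    by simp [hu0], ?_, fun j hj => ?_, ?_⟩
  · dsimp only
    split_ifs
    · exact hu hab
    · exact hu (by omega)
    · omega
    · exact hu (by omega)
  · dsimp only
    rw [if_neg (by omega), hun]
  · dsimp only
    split_ifs
    · exact huδ j (by omega)
    · obtain rfl : j = k := by omega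
      rcases hd with hd | hd
      · rw [hd]; exact huδ _ (by omega)
      · rw [← hd]; exact huδ _ (by omega)
    · omega
    · exact huδ _ (by omega)
  · simp only [hγu]
    rwa [sum_dist_remove (fun i => γ (u i)) hk hd]

/-! ### From polygons to the curve, and growth -/

/-- The length of a unit speed curve in a ball is controlled by its total curvature. -/
theorem IsCAT0.le_mul_one_add_tau (hX : IsCAT0 X) {γ : ℝ → X} (hγ : HasUnitSpeedOn γ (Ici 0))
    {t r T : ℝ} (ht : 0 < t) (hT : 0 ≤ T) (hτ : tau γ t ≤ ENNReal.ofReal T)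
    (hr : γ '' Icc 0 t ⊆ Metric.closedBall (γ 0) r) : t ≤ r * (1 + T) := by
  have hr0 : 0 ≤ r := dist_nonneg.trans (hr ⟨0, ⟨le_rfl, ht.le⟩, rfl⟩)
  suffices h : ∀ ε > 0, ε ≤ t → t - ε ≤ r * (1 + (T + ε)) by
    have hcont : Tendsto (fun ε : ℝ => r * (1 + (T + ε)) - (t - ε)) (𝓝[>] 0)
        (𝓝 (r * (1 + (T + 0)) - (t - 0))) :=
      Tendsto.mono_left (Continuous.tendsto (by fun_prop) 0) nhdsWithin_le_nhds
    have := ge_of_tendsto hcont (b := 0) (by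
      filter_upwards [Ioc_mem_nhdsGT ht] with ε hε
      exact sub_nonneg.2 (h ε hε.1 hε.2))
    simpa using this
  intro ε hε hεt
  have hlt : totalCurvature γ 0 t < ENNReal.ofReal (T + ε) :=
    hτ.trans_lt ((ENNReal.ofReal_lt_ofReal_iff (by linarith)).2 (by linarith))
  rw [totalCurvature] at hlt
  simp only [iInf_lt_iff] at hlt
  obtain ⟨δ, hδ, hlt⟩ := hlt
  obtain ⟨n, u, hu, huδ, hsum⟩ := exists_isInscribed hγ ht hε hεt hδ
  have hrot : totalRotation n (fun i => γ (u i)) ≤ T + ε := by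
    refine (ENNReal.ofReal_le_ofReal_iff (by linarith)).1 (le_trans ?_ hlt.le)
    exact le_iSup_of_le n (le_iSup_of_le u (le_iSup_of_le hu (le_iSup_of_le huδ le_rfl)))
  have hlow : ∀ i ≤ n, 0 ≤ u i := by
    intro i
    induction i with
    | zero => exact fun _ => hu.1.ge
    | succ i ih => exact fun hi => (ih (by omega)).trans (hu.2.2 i (by omega)).1.le
  have hupp : ∀ j ≤ n, u (n - j) ≤ t := by
    intro j
    induction j with
    | zero => exact fun _ => hu.2.1.le
    | succ j ih =>
      intro hj
      have := (hu.2.2 (n - (j + 1)) (by omega)).1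
      rw [show n - (j + 1) + 1 = n - j by omega] at this
      exact this.le.trans (ih (by omega))
  have hpoly := hX.sum_dist_le (r := r) (fun i => γ (u i)) n (fun i hi => (hu.2.2 i hi).2)
    (fun i hi => by
      rw [hu.1, dist_comm]
      refine hr ⟨u i, ⟨hlow i hi, ?_⟩, rfl⟩
      have := hupp (n - i) (by omega)
      rwa [show n - (n - i) = i by omega] at this)
  have := mul_le_mul_of_nonneg_left hrot hr0
  linarith

theorem IsCAT0.not_isBounded (hX : IsCAT0 X) {γ : ℝ → X} (hγ : HasUnitSpeedOn γ (Ici 0))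
    (h : liminf (fun t : ℝ => tau γ t / ENNReal.ofReal t) atTop = 0) :
    ¬ Bornology.IsBounded (γ '' Ici 0) := by
  intro hb
  obtain ⟨r, hr1, hr⟩ := hb.subset_closedBall_lt 0 (γ 0)
  have hpos : (0 : ℝ≥0∞) < ENNReal.ofReal (1 / (2 * r)) := ENNReal.ofReal_pos.2 (by positivity)
  have hle : ENNReal.ofReal (1 / (2 * r)) ≤
      liminf (fun t : ℝ => tau γ t / ENNReal.ofReal t) atTop := by
    refine le_liminf_of_le (by isBoundedDefault) ?_
    -- For `t ≥ 2r`, `τ ≥ t / r - 1 ≥ t / (2r)`.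
    filter_upwards [eventually_ge_atTop (2 * r)] with t ht
    have ht0 : 0 < t := by linarith
    rw [ENNReal.le_div_iff_mul_le (Or.inl (by simpa using ht0)) (Or.inl ENNReal.ofReal_ne_top),
      ← ENNReal.ofReal_mul (by positivity)]
    rcases eq_or_ne (tau γ t) ⊤ with htop | htop
    · rw [htop]; exact le_top
    refine ENNReal.ofReal_le_of_le_toReal ?_
    have := hX.le_mul_one_add_tau hγ ht0 ENNReal.toReal_nonneg (ENNReal.ofReal_toReal htop).ge
      ((image_mono Icc_subset_Ici_self).trans hr)
    rw [div_mul_eq_mul_div, one_mul, div_le_iff₀ (by positivity)]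
    linarith
  exact (hpos.trans_le hle).ne' h

theorem IsCAT0.rpow_le_circumradius (hX : IsCAT0 X) {γ : ℝ → X} (hγ : HasUnitSpeedOn γ (Ici 0))
    {a A t : ℝ} (ha : 0 ≤ a) (ht : 1 ≤ t) (hτ : tau γ t ≤ ENNReal.ofReal (A * t ^ a)) :
    1 / (1 + |A|) * t ^ (1 - a) ≤ circumradius γ t := by
  have ht0 : 0 < t := by linarith
  refine le_csInf ⟨t, ?_⟩ fun r hr => ?_
  · rintro _ ⟨s, hs, rfl⟩
    rw [Metric.mem_closedBall, dist_comm]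
    linarith [dist_le_of_hasUnitSpeedOn hγ le_rfl hs.1, hs.2]
  have hta : 0 < t ^ a := Real.rpow_pos_of_pos ht0 a
  have hta1 : 1 ≤ t ^ a := Real.one_le_rpow ht ha
  have hr0 : 0 ≤ r := dist_nonneg.trans (hr ⟨0, ⟨le_rfl, ht0.le⟩, rfl⟩)
  have h := hX.le_mul_one_add_tau hγ ht0 (T := |A| * t ^ a) (by positivity)
    (hτ.trans (ENNReal.ofReal_le_ofReal (mul_le_mul_of_nonneg_right (le_abs_self A) hta.le))) hr
  have hA : 0 < 1 + |A| := by positivity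
  -- Since `t ^ a ≥ 1`, the summand `1` is absorbed, which gives the constant `1 / (1 + |A|)`.
  have h2 : r * (1 + |A| * t ^ a) ≤ r * ((1 + |A|) * t ^ a) :=
    mul_le_mul_of_nonneg_left (by linarith) hr0
  rw [Real.rpow_sub ht0, Real.rpow_one, div_mul_div_comm, one_mul, div_le_iff₀ (by positivity)]
  linarith

end CurveCAT0

theorem mainTheorem2 {X : Type*} [MetricSpace X] (hX : CurveCAT0.IsCAT0 X)
    (γ : ℝ → X) (hγ : HasUnitSpeedOn γ (Ici 0)) :
    (liminf (fun t : ℝ => CurveCAT0.tau γ t / ENNReal.ofReal t) atTop = 0 →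
      ¬ Bornology.IsBounded (γ '' Ici 0)) ∧
    (∀ a ∈ Ioo (0 : ℝ) 1,
      (∃ A : ℝ, ∀ᶠ t : ℝ in atTop, CurveCAT0.tau γ t ≤ ENNReal.ofReal (A * t ^ a)) →
      ∃ k : ℝ, 0 < k ∧ ∀ᶠ t : ℝ in atTop, k * t ^ (1 - a) ≤ CurveCAT0.circumradius γ t) := by
  refine ⟨hX.not_isBounded hγ, fun a ha ⟨A, hA⟩ => ⟨1 / (1 + |A|), by positivity, ?_⟩⟩
  filter_upwards [hA, eventually_ge_atTop 1] with t hτ ht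
  exact hX.rpow_le_circumradius hγ ha.1.le ht hτ
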